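/- Let $G$ be a (finite dimensional, real) Lie group with a smooth left action $l^Q$, $l^Q_g(q)=gq$, on a finite dimensional smooth manifold $Q$ (without boundary) such that the quotient map $\pi:Q\to Q/G$ is a smooth principal $G$-bundle. A *discrete connection* $\mathcal A_d$ on $\pi$ is a (regular) submanifold $Hor\subset Q\times Q$ that is invariant under the diagonal $G$-action, contains the diagonal of $Q\times Q$, and is such that $(id_Q\times\pi)|_{Hor}:Hor\to Q\times(Q/G)$ is an injective local diffeomorphism. Put $$\mathfrak U:=\{(q_0,gq_1):(q_0,q_1)\in Hor,\ g\in G\}\subset Q\times Q,\qquad \mathfrak U':=(id_Q\times\pi)(Hor)\subset Q\times (Q/G);$$ $\mathfrak U$ is called the *domain* of $\mathcal A_d$. The *associated discrete horizontal lift* $h_d:\mathfrak U'\to Q\times Q$ is the inverse of the bijection $(id_Q\times\pi)|_{Hor}:Hor\to\mathfrak U'$; that is, $h_d(q_0,r_1)=(q_0,q_1)$ if and only if $(q_0,q_1)\in Hor$ and $\pi(q_1)=r_1$. A *discrete horizontal lift on $\pi$* is a map $h:\mathcal U'\to Q\times Q$ with the following properties: 1. $\mathcal U'\subset Q\times(Q/G)$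 is open and invariant under the $G$-action $g\cdot(q_0,r_1):=(gq_0,r_1)$; 2. $h$ is smooth, and $G$-equivariant for this action on $\mathcal U'$ and the diagonal action on $Q\times Q$; 3. $h$ is a section of $id_Q\times\pi$ over $\mathcal U'$, i.e. $(id_Q\times\pi)\circ h=id_{\mathcal U'}$; 4. for every $q\in Q$, $(q,\pi(q))\in\mathcal U'$ and $h(q,\pi(q))=(q,q)$. **Theorem.** If $\mathcal A_d$ is a discrete connection on $\pi$, then its associated discrete horizontal lift $h_d:\mathfrak U'\to Q\times Q$ is a discrete horizontal lift on $\pi$. Conversely, if $h:\mathcal U'\to Q\times Q$ is a discrete horizontal lift on $\pi$, then there exists a unique discrete connection $\mathcal A_d$ on $\pi$ with domain $\mathfrak U=(id_Q\times\pi)^{-1}(\mathcal U')$ such that $\mathfrak U'=\mathcal U'$ and $h_d=h$. -/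

import Mathlib

open scoped Manifold ContDiff Topology

namespace DiscreteConn

/-- The quotient map `π : Q → Q/G` onto the space of orbits. The space of orbits
`MulAction.orbitRel.Quotient G Q` carries Mathlib's quotient topology. -/
def quotientMap (G Q : Type*) [Group G] [MulAction G Q] (q : Q) :
    MulAction.orbitRel.Quotient G Q :=
  Quotient.mk _ q

/-- The map `id × π : Q × Q → Q × (Q/G)`. -/
def idProdQuotient (G Q : Type*) [Group G] [MulAction G Q] :
    Q × Q → Q × MulAction.orbitRel.Quotient G Q :=
  Prod.map id (quotientMap G Q)

/-- For a Lie group `G` acting (on the left) on the manifold `Q`, with a given manifold structure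
on `Q/G` (compatible with the quotient topology), `π : Q → Q/G` is a smooth principal `G`-bundle:
the action is smooth, and over a neighbourhood `V` of every point of `Q/G` there is a
diffeomorphism `π⁻¹(V) ≅ V × G` over `V` which intertwines the action on `Q` with the left
translations of `G`. -/
structure IsPrincipalBundle
    {E H : Type*} [NormedAddCommGroup E] [NormedSpace ℝ E] [TopologicalSpace H]
    (I : ModelWithCorners ℝ E H)
    {EG HG : Type*} [NormedAddCommGroup EG] [NormedSpace ℝ EG] [TopologicalSpace HG]
    (IG : ModelWithCorners ℝ EG HG)
    {EB HB : Type*} [NormedAddCommGroup EB] [NormedSpace ℝ EB] [TopologicalSpace HB]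
    (IB : ModelWithCorners ℝ EB HB)
    (G Q : Type*) [Group G] [TopologicalSpace G] [ChartedSpace HG G]
    [TopologicalSpace Q] [ChartedSpace H Q] [MulAction G Q]
    [ChartedSpace HB (MulAction.orbitRel.Quotient G Q)] : Prop where
  contMDiff_smul : ContMDiff (IG.prod I) I ∞ (fun p : G × Q => p.1 • p.2)
  exists_trivialization : ∀ b : MulAction.orbitRel.Quotient G Q,
    ∃ (V : Set (MulAction.orbitRel.Quotient G Q))
      (e : OpenPartialHomeomorph Q (MulAction.orbitRel.Quotient G Q × G)),
      IsOpen V ∧ b ∈ V ∧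
      e.source = quotientMap G Q ⁻¹' V ∧ e.target = V ×ˢ Set.univ ∧
      ContMDiffOn I (IB.prod IG) ∞ e e.source ∧
      ContMDiffOn (IB.prod IG) I ∞ e.symm e.target ∧
      (∀ q ∈ e.source, (e q).1 = quotientMap G Q q) ∧
      (∀ (g : G), ∀ q ∈ e.source, e (g • q) = ((e q).1, g * (e q).2))

/-- The structure of an embedded (regular) smooth submanifold on a subset `S` of a finite
dimensional smooth manifold `M`: a smooth manifold structure of some dimension `dim` on `S` (with
the subspace topology) for which the inclusion `S → M` is a smooth embedding. On a given subset
there is at most one such smooth structure. -/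
structure EmbeddedSubmanifold
    {E H : Type*} [NormedAddCommGroup E] [NormedSpace ℝ E] [TopologicalSpace H]
    (I : ModelWithCorners ℝ E H)
    {M : Type*} [TopologicalSpace M] [ChartedSpace H M] (S : Set M) where
  dim : ℕ
  chartedSpace : ChartedSpace (EuclideanSpace ℝ (Fin dim)) S
  isManifold : IsManifold (𝓡 dim) ∞ S
  isSmoothEmbedding : Manifold.IsSmoothEmbedding (𝓡 dim) I ∞ (Subtype.val : S → M)

/-- With respect to the submanifold structure `σ` on `S ⊆ M`, the restriction `f|_S : S → N` is a
local diffeomorphism. -/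
def EmbeddedSubmanifold.IsLocalDiffeomorphRestrict
    {E H : Type*} [NormedAddCommGroup E] [NormedSpace ℝ E] [TopologicalSpace H]
    {I : ModelWithCorners ℝ E H}
    {E' H' : Type*} [NormedAddCommGroup E'] [NormedSpace ℝ E'] [TopologicalSpace H']
    (I' : ModelWithCorners ℝ E' H')
    {M : Type*} [TopologicalSpace M] [ChartedSpace H M] {S : Set M}
    {N : Type*} [TopologicalSpace N] [ChartedSpace H' N]
    (σ : EmbeddedSubmanifold I S) (f : M → N) : Prop :=
  letI := σ.chartedSpace
  IsLocalDiffeomorph (𝓡 σ.dim) I' ∞ (S.domRestrict f)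

/-- A discrete connection on `π : Q → Q/G`: a submanifold `Hor ⊆ Q × Q`, invariant under the
diagonal `G`-action, containing the diagonal, and such that
`(id × π)|_Hor : Hor → Q × (Q/G)` is an injective local diffeomorphism. -/
@[ext]
structure DiscreteConnection
    {E H : Type*} [NormedAddCommGroup E] [NormedSpace ℝ E] [TopologicalSpace H]
    (I : ModelWithCorners ℝ E H)
    {EB HB : Type*} [NormedAddCommGroup EB] [NormedSpace ℝ EB] [TopologicalSpace HB]
    (IB : ModelWithCorners ℝ EB HB)
    (G Q : Type*) [Group G] [TopologicalSpace Q] [ChartedSpace H Q] [MulAction G Q]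
    [ChartedSpace HB (MulAction.orbitRel.Quotient G Q)] where
  Hor : Set (Q × Q)
  smul_mem : ∀ (g : G) (q₀ q₁ : Q), (q₀, q₁) ∈ Hor → (g • q₀, g • q₁) ∈ Hor
  diag_mem : ∀ q : Q, (q, q) ∈ Hor
  injOn : Set.InjOn (idProdQuotient G Q) Hor
  exists_localDiffeomorph : ∃ σ : EmbeddedSubmanifold (I.prod I) Hor,
    σ.IsLocalDiffeomorphRestrict (I.prod IB) (idProdQuotient G Q)

namespace DiscreteConnection

variable {E H : Type*} [NormedAddCommGroup E] [NormedSpace ℝ E] [TopologicalSpace H]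
  {I : ModelWithCorners ℝ E H}
  {EB HB : Type*} [NormedAddCommGroup EB] [NormedSpace ℝ EB] [TopologicalSpace HB]
  {IB : ModelWithCorners ℝ EB HB}
  {G Q : Type*} [Group G] [TopologicalSpace Q] [ChartedSpace H Q] [MulAction G Q]
  [ChartedSpace HB (MulAction.orbitRel.Quotient G Q)]

/-- The domain `U = {(q₀, g • q₁) : (q₀, q₁) ∈ Hor, g ∈ G}` of a discrete connection. -/
def domain (A : DiscreteConnection I IB G Q) : Set (Q × Q) :=
  {p | ∃ (q₀ q₁ : Q) (g : G), (q₀, q₁) ∈ A.Hor ∧ p = (q₀, g • q₁)}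

/-- The set `U' = (id × π)(Hor) ⊆ Q × (Q/G)`. -/
abbrev baseDomain (A : DiscreteConnection I IB G Q) :
    Set (Q × MulAction.orbitRel.Quotient G Q) :=
  idProdQuotient G Q '' A.Hor

/-- The discrete horizontal lift `U' → Q × Q` associated to a discrete connection: the inverse of
the bijection `(id × π)|_Hor : Hor → U'`, followed by the inclusion of `Hor`. -/
noncomputable def horizontalLift (A : DiscreteConnection I IB G Q) (x : A.baseDomain) : Q × Q :=
  ((Equiv.Set.imageOfInjOn (idProdQuotient G Q) A.Hor A.injOn).symm x : A.Hor)

/-- The explicit description of the discrete horizontal lift. -/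
theorem horizontalLift_eq_iff (A : DiscreteConnection I IB G Q) (x : A.baseDomain) (p : Q × Q) :
    A.horizontalLift x = p ↔ p ∈ A.Hor ∧ idProdQuotient G Q p = x := by
  unfold horizontalLift
  constructor
  · rintro rfl
    refine ⟨Subtype.property _, ?_⟩
    exact congrArg Subtype.val
      ((Equiv.Set.imageOfInjOn (idProdQuotient G Q) A.Hor A.injOn).apply_symm_apply x)
  · rintro ⟨hp, hx⟩
    have h : (Equiv.Set.imageOfInjOn (idProdQuotient G Q) A.Hor A.injOn).symm x = ⟨p, hp⟩ := by
      rw [Equiv.symm_apply_eq]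
      exact Subtype.ext hx.symm
    rw [h]

end DiscreteConnection

/-- A map `h : U' → Q × Q` defined on a subset `U' ⊆ Q × (Q/G)` is a discrete horizontal lift. -/
structure IsDiscreteHorizontalLift
    {E H : Type*} [NormedAddCommGroup E] [NormedSpace ℝ E] [TopologicalSpace H]
    (I : ModelWithCorners ℝ E H)
    {EB HB : Type*} [NormedAddCommGroup EB] [NormedSpace ℝ EB] [TopologicalSpace HB]
    (IB : ModelWithCorners ℝ EB HB)
    {G Q : Type*} [Group G] [TopologicalSpace Q] [ChartedSpace H Q] [MulAction G Q]
    [ChartedSpace HB (MulAction.orbitRel.Quotient G Q)]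
    (U' : Set (Q × MulAction.orbitRel.Quotient G Q)) (h : U' → Q × Q) : Prop where
  isOpen : IsOpen U'
  /-- `U'` is invariant under the action `g • (q₀, r₁) = (g • q₀, r₁)`. -/
  smul_mem : ∀ (g : G), ∀ x ∈ U', (g • x.1, x.2) ∈ U'
  /-- `h` is smooth on the open submanifold `U'` of `Q × (Q/G)`. -/
  contMDiff : ContMDiff (I.prod IB) (I.prod I) ∞
    (fun x : (⟨U', isOpen⟩ : TopologicalSpace.Opens (Q × MulAction.orbitRel.Quotient G Q)) =>
      h ⟨x.1, x.2⟩)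
  /-- `h` is equivariant for the above action and the diagonal action on `Q × Q`. -/
  equivariant : ∀ (g : G) (x : Q × MulAction.orbitRel.Quotient G Q) (hx : x ∈ U'),
    h ⟨(g • x.1, x.2), smul_mem g x hx⟩ = (g • (h ⟨x, hx⟩).1, g • (h ⟨x, hx⟩).2)
  /-- `h` is a section of `id × π` over `U'`. -/
  is_section : ∀ x : U', idProdQuotient G Q (h x) = x
  diag_mem : ∀ q : Q, (q, quotientMap G Q q) ∈ U'
  map_diag : ∀ q : Q, h ⟨(q, quotientMap G Q q), diag_mem q⟩ = (q, q)

end DiscreteConn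

/-! A connection and its lift determine each other through `Hor = range h`. From connection to lift:
a local diffeomorphism has open image, and near each point of `U'` the lift is a local inverse of
`(id × π)|_Hor` followed by the smooth inclusion of `Hor`; injectivity forces the agreement.
Equivariance also follows from injectivity. From lift to connection: `h` and `id × π` are inverse
homeomorphisms between `range h` and the open set `U'`, so `range h` inherits a Euclidean manifold
structure making `id × π` a local diffeomorphism (`exists_euclidean_manifold`). The real work is to
show that the inclusion into `Q × Q` is an immersion. Over a trivialization of `π`, dividing the
`G`-coordinate of `q₁` by that of the lift gives a partial diffeomorphism sending `range h` into the
slice `g = 1` (`exists_partialDiffeomorph`), and `of_straightening` turns such a slice into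
immersion charts. Uniqueness holds because `Hor` is the range of the lift. -/

/-! ### Partial diffeomorphisms, immersions and transported manifold structures -/

section Manifold

open Set Module

variable {E H : Type*} [NormedAddCommGroup E] [NormedSpace ℝ E] [TopologicalSpace H]
  {I : ModelWithCorners ℝ E H}
  {M : Type*} [TopologicalSpace M] [ChartedSpace H M]
  {E' H' : Type*} [NormedAddCommGroup E'] [NormedSpace ℝ E'] [TopologicalSpace H']
  {J : ModelWithCorners ℝ E' H'}
  {N : Type*} [TopologicalSpace N] [ChartedSpace H' N]
  {n : ℕ∞ω}

/-- A boundaryless model with corners, as a diffeomorphism of the model space onto the model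
vector space. -/
noncomputable def ModelWithCorners.toDiffeomorph (I : ModelWithCorners ℝ E H) [I.Boundaryless]
    (n : ℕ∞ω) : H ≃ₘ^n⟮I, 𝓘(ℝ, E)⟯ E where
  toEquiv := I.toHomeomorph.toEquiv
  contMDiff_toFun := I.contMDiff
  contMDiff_invFun := by
    have := I.contMDiffOn_symm (n := n)
    rw [I.range_eq_univ] at this
    exact contMDiffOn_univ.1 this

/-- A member of the maximal atlas, as a partial diffeomorphism onto the model space. -/
def PartialDiffeomorph.ofMemMaximalAtlas [IsManifold I n M] {e : OpenPartialHomeomorph M H}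
    (he : e ∈ IsManifold.maximalAtlas I n M) : PartialDiffeomorph I I M H n where
  toPartialEquiv := e.toPartialEquiv
  open_source := e.open_source
  open_target := e.open_target
  contMDiffOn_toFun := contMDiffOn_of_mem_maximalAtlas he
  contMDiffOn_invFun := contMDiffOn_symm_of_mem_maximalAtlas he

theorem PartialDiffeomorph.mem_maximalAtlas [IsManifold I n M]
    (Φ : PartialDiffeomorph I I M H n) :
    Φ.toOpenPartialHomeomorph ∈ IsManifold.maximalAtlas I n M :=
  OpenPartialHomeomorph.mem_maximalAtlas_of_contMDiffOn _ Φ.contMDiffOn_toFun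
    Φ.contMDiffOn_invFun

/-- The extended chart at a point of a boundaryless manifold, as a partial diffeomorphism. -/
noncomputable def PartialDiffeomorph.extChart (I : ModelWithCorners ℝ E H) [I.Boundaryless]
    (n : ℕ∞ω) [IsManifold I n M] (x : M) : PartialDiffeomorph I 𝓘(ℝ, E) M E n :=
  (ofMemMaximalAtlas (IsManifold.chart_mem_maximalAtlas x)).trans
    (I.toDiffeomorph n).toPartialDiffeomorph

theorem PartialDiffeomorph.mem_extChart_source [I.Boundaryless] [IsManifold I n M] (x : M) :
    x ∈ (extChart I n x).source := by
  refine ⟨mem_chart_source H x, ?_⟩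
  trivial

/-- A continuous linear equivalence is a `C^n` diffeomorphism for every `n`. -/
def ContinuousLinearEquiv.toContMDiffDiffeomorph (A : E ≃L[ℝ] E') (n : ℕ∞ω) :
    E ≃ₘ^n⟮𝓘(ℝ, E), 𝓘(ℝ, E')⟯ E' where
  toEquiv := A.toEquiv
  contMDiff_toFun := A.contDiff.contMDiff
  contMDiff_invFun := A.symm.contDiff.contMDiff

/-- The product of two partial diffeomorphisms. -/
def PartialDiffeomorph.prod {E₁ H₁ M₁ E₂ H₂ M₂ : Type*}
    [NormedAddCommGroup E₁] [NormedSpace ℝ E₁] [TopologicalSpace H₁]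
    {I₁ : ModelWithCorners ℝ E₁ H₁} [TopologicalSpace M₁] [ChartedSpace H₁ M₁]
    [NormedAddCommGroup E₂] [NormedSpace ℝ E₂] [TopologicalSpace H₂]
    {I₂ : ModelWithCorners ℝ E₂ H₂} [TopologicalSpace M₂] [ChartedSpace H₂ M₂]
    (Φ : PartialDiffeomorph I I₁ M M₁ n) (Ψ : PartialDiffeomorph J I₂ N M₂ n) :
    PartialDiffeomorph (I.prod J) (I₁.prod I₂) (M × N) (M₁ × M₂) n where
  toPartialEquiv := Φ.toPartialEquiv.prod Ψ.toPartialEquiv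
  open_source := Φ.open_source.prod Ψ.open_source
  open_target := Φ.open_target.prod Ψ.open_target
  contMDiffOn_toFun := Φ.contMDiffOn_toFun.prodMap Ψ.contMDiffOn_toFun
  contMDiffOn_invFun := Φ.contMDiffOn_invFun.prodMap Ψ.contMDiffOn_invFun

/-- A map which reads `y ↦ (φ y, c)` after applying a partial diffeomorphism `Ψ` of its codomain,
for a local diffeomorphism `φ`, is an immersion. -/
theorem Manifold.IsImmersionAtOfComplement.of_straightening
    [I.Boundaryless] [J.Boundaryless] [IsManifold I n M] [IsManifold J n N] (hn : n ≠ 0)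
    {E₁ H₁ M₁ E₂ H₂ M₂ : Type*}
    [NormedAddCommGroup E₁] [NormedSpace ℝ E₁] [TopologicalSpace H₁]
    {I₁ : ModelWithCorners ℝ E₁ H₁} [I₁.Boundaryless] [TopologicalSpace M₁] [ChartedSpace H₁ M₁]
    [IsManifold I₁ n M₁]
    [NormedAddCommGroup E₂] [NormedSpace ℝ E₂] [TopologicalSpace H₂]
    {I₂ : ModelWithCorners ℝ E₂ H₂} [I₂.Boundaryless] [TopologicalSpace M₂] [ChartedSpace H₂ M₂]
    [IsManifold I₂ n M₂]
    {f : M → N} {x : M} (hf : ContinuousAt f x) {φ : M → M₁}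
    (hφ : IsLocalDiffeomorphAt I I₁ n φ x)
    (Ψ : PartialDiffeomorph J (I₁.prod I₂) N (M₁ × M₂) n) (hx : f x ∈ Ψ.source) {c : M₂}
    (hΨ : ∀ y, f y ∈ Ψ.source → Ψ (f y) = (φ y, c)) :
    IsImmersionAtOfComplement E₂ I J n f x := by
  -- The derivatives serve only to identify the model vector spaces linearly; any such equivalences
  -- would do.
  let A : E ≃L[ℝ] E₁ := hφ.mfderivToContinuousLinearEquiv hn
  let B : E' ≃L[ℝ] E₁ × E₂ :=
    (Ψ.isLocalDiffeomorphAt _ _ _ hx).mfderivToContinuousLinearEquiv hn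
  obtain ⟨Φ, hxΦ, hΦ⟩ := hφ
  let c₁ := PartialDiffeomorph.extChart I₁ n (φ x)
  let c₂ := (PartialDiffeomorph.extChart I₂ n c)
  -- Translation moves the constant `c` to the origin, since the normal form of an immersion is `u ↦
  -- (u, 0)`.
  let t : E₂ ≃ₘ^n⟮𝓘(ℝ, E₂), 𝓘(ℝ, E₂)⟯ E₂ :=
    { toEquiv := Equiv.subRight (c₂ c)
      contMDiff_toFun := contMDiff_id.sub contMDiff_const
      contMDiff_invFun := contMDiff_id.add contMDiff_const }
  let dom : PartialDiffeomorph I I M H n :=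
    ((Φ.trans c₁).trans (A.symm.toContMDiffDiffeomorph n).toPartialDiffeomorph).trans
      (I.toDiffeomorph n).symm.toPartialDiffeomorph
  let B' : (E₁ × E₂) ≃ₘ^n⟮𝓘(ℝ, E₁).prod 𝓘(ℝ, E₂), 𝓘(ℝ, E')⟯ E' :=
    { toEquiv := B.symm.toEquiv
      contMDiff_toFun :=
        B.symm.contDiff.contMDiff.comp (contMDiff_fst.prodMk_space contMDiff_snd)
      contMDiff_invFun :=
        ContMDiff.prodMk (contDiff_fst.comp B.contDiff).contMDiff
          (contDiff_snd.comp B.contDiff).contMDiff }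
  let cod : PartialDiffeomorph J J N H' n :=
    ((Ψ.trans (c₁.prod (c₂.trans t.toPartialDiffeomorph))).trans B'.toPartialDiffeomorph).trans
      (J.toDiffeomorph n).symm.toPartialDiffeomorph
  have hx₁ : φ x ∈ c₁.source := PartialDiffeomorph.mem_extChart_source _
  have hc₂ : c ∈ c₂.source := PartialDiffeomorph.mem_extChart_source _
  -- Shrinking the domain chart to `s` keeps its image under `f` inside the source of `Ψ`.
  obtain ⟨s, hs, hso, hxs⟩ := mem_nhds_iff.1 (hf (Ψ.open_source.mem_nhds hx))
  have hcod : ∀ y ∈ dom.source ∩ s, f y ∈ cod.source := by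
    rintro y ⟨⟨⟨⟨hy, hy'⟩, -⟩, -⟩, hys⟩
    refine ⟨⟨⟨hs hys, ?_⟩, trivial⟩, trivial⟩
    change Ψ (f y) ∈ c₁.source ×ˢ (c₂.source ∩ c₂ ⁻¹' univ)
    rw [hΨ y (hs hys), hΦ hy]
    exact ⟨hy', hc₂, trivial⟩
  have hxdom : x ∈ dom.source := by
    refine ⟨⟨⟨hxΦ, ?_⟩, trivial⟩, trivial⟩
    change Φ x ∈ c₁.source
    rwa [← hΦ hxΦ]
  refine .mk_of_charts ((A.prodCongr (.refl ℝ E₂)).trans B.symm)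
    (dom.toOpenPartialHomeomorph.restr s) cod.toOpenPartialHomeomorph ?_ (hcod x ⟨hxdom, hxs⟩)
    (restr_mem_maximalAtlas (contDiffGroupoid n I) dom.mem_maximalAtlas hso)
    cod.mem_maximalAtlas ?_ ?_
  · rw [OpenPartialHomeomorph.restr_source' _ _ hso]
    exact ⟨hxdom, hxs⟩
  · intro y hy
    rw [OpenPartialHomeomorph.restr_source' _ _ hso] at hy
    exact hcod y hy
  · intro z hz
    rw [OpenPartialHomeomorph.extend_target_eq_image_source] at hz
    obtain ⟨y, hy, rfl⟩ := hz
    rw [← OpenPartialHomeomorph.extend_source (I := I)] at hy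
    simp only [Function.comp_apply]
    rw [OpenPartialHomeomorph.extend_left_inv _
      (by rwa [OpenPartialHomeomorph.extend_source] at hy)]
    rw [OpenPartialHomeomorph.extend_source, OpenPartialHomeomorph.restr_source' _ _ hso] at hy
    obtain ⟨hyd, hys⟩ := hy
    have hyΦ : y ∈ Φ.source := hyd.1.1.1
    have h₁ : (cod.toOpenPartialHomeomorph.extend J) (f y) =
        J (J.symm (B.symm (c₁ (Ψ (f y)).1, c₂ (Ψ (f y)).2 - c₂ c))) := rfl
    have h₂ : ((dom.toOpenPartialHomeomorph.restr s).extend I) y =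
        I (I.symm (A.symm (c₁ (Φ y)))) := rfl
    rw [h₁, h₂, J.right_inv (by simp [J.range_eq_univ]), I.right_inv (by simp [I.range_eq_univ]),
      hΨ y (hs hys), hΦ hyΦ]
    simp

/-- The domain of an open embedding into a finite dimensional boundaryless manifold carries a
manifold structure, modelled on a Euclidean space, for which the map is a local diffeomorphism. -/
theorem Topology.IsOpenEmbedding.exists_euclidean_manifold [FiniteDimensional ℝ E']
    [J.Boundaryless] [IsManifold J n N] {S : Type*} [TopologicalSpace S] {f : S → N}
    (hf : IsOpenEmbedding f) :
    ∃ _ : ChartedSpace (EuclideanSpace ℝ (Fin (finrank ℝ E'))) S,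
      IsManifold (𝓡 (finrank ℝ E')) n S ∧ IsLocalDiffeomorph (𝓡 (finrank ℝ E')) J n f := by
  set D := finrank ℝ E'
  let L : E' ≃L[ℝ] EuclideanSpace ℝ (Fin D) :=
    .ofFinrankEq (by simp [D])
  let ψ : H' ≃ₘ^n⟮J, 𝓡 D⟯ EuclideanSpace ℝ (Fin D) :=
    (J.toDiffeomorph n).trans (L.toContMDiffDiffeomorph n)
  have key : ∀ x : S, ∃ F : OpenPartialHomeomorph S N, F.source = univ ∧ ∀ y, F y = f y :=
    fun x ↦ haveI : Nonempty S := ⟨x⟩; ⟨hf.toOpenPartialHomeomorph f, by simp, by simp⟩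
  choose F hF hFf using key
  -- The charts are those of `N` pulled back along `f`; in a transition map `f` cancels, leaving a
  -- transition map of `N` conjugated by `ψ`.
  let ch : S → OpenPartialHomeomorph S (EuclideanSpace ℝ (Fin D)) := fun x ↦
    ((F x).trans (chartAt H' (f x))).trans ψ.toHomeomorph.toOpenPartialHomeomorph
  let _cs : ChartedSpace (EuclideanSpace ℝ (Fin D)) S :=
    { atlas := range ch
      chartAt := ch
      mem_chart_source := fun x ↦ by simp [ch, hF, hFf]
      chart_mem_atlas := mem_range_self }
  have : IsManifold (𝓡 D) n S := by
    apply isManifold_of_contDiffOn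
    rintro _ _ ⟨x, rfl⟩ ⟨y, rfl⟩
    have hinv : ∀ w ∈ (F x).target, f ((F x).symm w) = w := fun w hw ↦ by
      rw [← hFf x, (F x).right_inv hw]
    have h : ContMDiffOn (𝓡 D) (𝓡 D) n
        (ψ ∘ chartAt H' (f y) ∘ (chartAt H' (f x)).symm ∘ ψ.symm)
        ((ch x).symm.trans (ch y)).source := by
      refine ψ.contMDiff.comp_contMDiffOn (contMDiffOn_chart.comp
        (contMDiffOn_chart_symm.comp ψ.symm.contMDiff.contMDiffOn ?_) ?_)
      · rintro z ⟨⟨-, hz, -⟩, -⟩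
        exact hz
      · rintro z ⟨⟨-, hz, hz'⟩, ⟨-, hz''⟩, -⟩
        change F y ((F x).symm ((chartAt H' (f x)).symm (ψ.symm z))) ∈
          (chartAt H' (f y)).source at hz''
        rwa [hFf, hinv ((chartAt H' (f x)).symm (ψ.symm z)) hz'] at hz''
    refine (contMDiffOn_iff_contDiffOn.1 h).congr_mono ?_ (by simp)
    rintro z ⟨⟨⟨-, hz, hz'⟩, -⟩, -⟩
    change ψ (chartAt H' (f y) (F y ((F x).symm ((chartAt H' (f x)).symm (ψ.symm z))))) = _
    rw [hFf, hinv ((chartAt H' (f x)).symm (ψ.symm z)) hz']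
    rfl
  refine ⟨_cs, this, fun x ↦ ?_⟩
  let e := PartialDiffeomorph.ofMemMaximalAtlas
    (IsManifold.chart_mem_maximalAtlas (I := 𝓡 D) (n := n) x)
  let c := PartialDiffeomorph.ofMemMaximalAtlas
    (IsManifold.chart_mem_maximalAtlas (I := J) (n := n) (f x))
  refine ⟨(e.trans ψ.symm.toPartialDiffeomorph).trans c.symm, ?_, ?_⟩
  · refine ⟨⟨mem_chart_source _ x, trivial⟩, ?_⟩
    change ψ.symm (ψ (chartAt H' (f x) (F x x))) ∈ (chartAt H' (f x)).target
    simp [hFf]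
  · rintro y ⟨⟨hy, -⟩, -⟩
    change y ∈ (ch x).source at hy
    change f y = (chartAt H' (f x)).symm (ψ.symm (ψ (chartAt H' (f x) (F x y))))
    have : f y ∈ (chartAt H' (f x)).source := by simpa [ch, hF, hFf] using hy
    simp [hFf, this]

end Manifold

/-! ### From a discrete connection to its horizontal lift -/

namespace DiscreteConn

open Set Module

variable {E H : Type*} [NormedAddCommGroup E] [NormedSpace ℝ E] [TopologicalSpace H]
  {I : ModelWithCorners ℝ E H}
  {EG HG : Type*} [NormedAddCommGroup EG] [NormedSpace ℝ EG] [TopologicalSpace HG]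
  {IG : ModelWithCorners ℝ EG HG}
  {EB HB : Type*} [NormedAddCommGroup EB] [NormedSpace ℝ EB] [TopologicalSpace HB]
  {IB : ModelWithCorners ℝ EB HB}
  {G Q : Type*} [Group G] [MulAction G Q]

@[simp]
theorem quotientMap_smul (g : G) (q : Q) : quotientMap G Q (g • q) = quotientMap G Q q :=
  Quotient.sound ⟨g, rfl⟩

theorem quotientMap_eq_iff {q q' : Q} :
    quotientMap G Q q = quotientMap G Q q' ↔ ∃ g : G, g • q' = q :=
  Quotient.eq.trans MulAction.orbitRel_apply

open Classical in
/-- The extension of a discrete horizontal lift to a function on all of `Q × (Q/G)`. -/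
noncomputable def IsDiscreteHorizontalLift.extend {U' : Set (Q × MulAction.orbitRel.Quotient G Q)}
    (h : U' → Q × Q) (x : Q × MulAction.orbitRel.Quotient G Q) : Q × Q :=
  -- The value off `U'` is arbitrary.
  if hx : x ∈ U' then h ⟨x, hx⟩ else (x.1, x.1)

@[simp]
theorem IsDiscreteHorizontalLift.extend_apply {U' : Set (Q × MulAction.orbitRel.Quotient G Q)}
    {h : U' → Q × Q} (x : U') : extend h x = h x := by
  simp [extend]

variable [TopologicalSpace Q] [ChartedSpace H Q]
  [ChartedSpace HB (MulAction.orbitRel.Quotient G Q)]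

theorem continuous_quotientMap : Continuous (quotientMap G Q) := continuous_quotient_mk'

theorem IsPrincipalBundle.exists_mem_source [TopologicalSpace G] [ChartedSpace HG G]
    (hπ : IsPrincipalBundle I IG IB G Q) (q : Q) :
    ∃ e : OpenPartialHomeomorph Q (MulAction.orbitRel.Quotient G Q × G), q ∈ e.source ∧
      (∃ V : Set (MulAction.orbitRel.Quotient G Q), IsOpen V ∧
        e.source = quotientMap G Q ⁻¹' V ∧ e.target = V ×ˢ Set.univ) ∧
      ContMDiffOn I (IB.prod IG) ∞ e e.source ∧
      ContMDiffOn (IB.prod IG) I ∞ e.symm e.target ∧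
      (∀ q ∈ e.source, (e q).1 = quotientMap G Q q) := by
  obtain ⟨V, e, hV, hb, hs, ht, he, he', hfst, -⟩ := hπ.exists_trivialization (quotientMap G Q q)
  exact ⟨e, by rwa [hs], ⟨V, hV, hs, ht⟩, he, he', hfst⟩

theorem DiscreteConnection.horizontalLift_mem (A : DiscreteConnection I IB G Q)
    (x : A.baseDomain) : A.horizontalLift x ∈ A.Hor :=
  ((A.horizontalLift_eq_iff x _).1 rfl).1

theorem DiscreteConnection.idProdQuotient_horizontalLift (A : DiscreteConnection I IB G Q)
    (x : A.baseDomain) : idProdQuotient G Q (A.horizontalLift x) = x :=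
  ((A.horizontalLift_eq_iff x _).1 rfl).2

/-- This recovers `Hor` from the lift, which gives uniqueness. -/
theorem DiscreteConnection.range_horizontalLift (A : DiscreteConnection I IB G Q) :
    range A.horizontalLift = A.Hor := by
  ext p
  refine ⟨?_, fun hp ↦ ⟨⟨_, mem_image_of_mem _ hp⟩, ?_⟩⟩
  · rintro ⟨x, rfl⟩
    exact A.horizontalLift_mem x
  · exact (A.horizontalLift_eq_iff _ p).2 ⟨hp, rfl⟩

theorem DiscreteConnection.isDiscreteHorizontalLift (A : DiscreteConnection I IB G Q) :
    IsDiscreteHorizontalLift I IB A.baseDomain A.horizontalLift := by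
  obtain ⟨σ, hσ⟩ := A.exists_localDiffeomorph
  let _ := σ.chartedSpace
  have hloc : IsLocalDiffeomorph (𝓡 σ.dim) (I.prod IB) ∞
    (A.Hor.domRestrict (idProdQuotient G Q)) := hσ
  have hopen : IsOpen A.baseDomain := by
    have := hloc.isOpen_range
    rwa [range_domRestrict] at this
  refine
    { isOpen := hopen
      smul_mem := ?_
      contMDiff := ?_
      equivariant := ?_
      is_section := A.idProdQuotient_horizontalLift
      diag_mem := fun q ↦ ⟨(q, q), A.diag_mem q, rfl⟩
      map_diag := fun q ↦ (A.horizontalLift_eq_iff _ _).2 ⟨A.diag_mem q, rfl⟩ }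
  · rintro g _ ⟨⟨q₀, q₁⟩, hp, rfl⟩
    exact ⟨(g • q₀, g • q₁), A.smul_mem g _ _ hp, by simp [idProdQuotient]⟩
  · rintro ⟨x, p, hp, rfl⟩
    have hp' : IsLocalDiffeomorphAt (𝓡 σ.dim) (I.prod IB) ∞
      (A.Hor.domRestrict (idProdQuotient G Q)) ⟨p, hp⟩ := hloc ⟨p, hp⟩
    have hinv := hp'.localInverse_contMDiffAt
    have hcomp : ContMDiffAt (I.prod IB) (I.prod I) ∞
        (fun x ↦ (hp'.localInverse x : Q × Q)) (idProdQuotient G Q p) :=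
      (σ.isSmoothEmbedding.contMDiff _).comp _ hinv
    have hsub := (contMDiffAt_subtype_iff (U := ⟨A.baseDomain, hopen⟩)
      (x := ⟨idProdQuotient G Q p, mem_image_of_mem _ hp⟩)).2 hcomp
    refine hsub.congr_of_eventuallyEq ?_
    have hnhds := continuous_subtype_val.continuousAt.preimage_mem_nhds
      (x := (⟨idProdQuotient G Q p, mem_image_of_mem _ hp⟩ : A.baseDomain))
      (hp'.localInverse_open_source.mem_nhds hp'.localInverse_mem_source)
    filter_upwards [hnhds] with x hx
    exact (A.horizontalLift_eq_iff _ _).2 ⟨Subtype.prop _, hp'.localInverse_right_inv hx⟩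
  · intro g x hx
    have h₁ := A.horizontalLift_mem ⟨x, hx⟩
    have h₂ := A.idProdQuotient_horizontalLift ⟨x, hx⟩
    refine (A.horizontalLift_eq_iff _ _).2 ⟨A.smul_mem g _ _ h₁, ?_⟩
    have h₃ := Prod.ext_iff.1 h₂
    simp only [idProdQuotient, Prod.map_fst, Prod.map_snd, id_eq] at h₃
    simp [idProdQuotient, h₃.1, h₃.2]

/-! ### From a horizontal lift to a discrete connection -/

namespace IsDiscreteHorizontalLift

variable {U' : Set (Q × MulAction.orbitRel.Quotient G Q)} {h : U' → Q × Q}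

theorem contMDiffOn_extend (hh : IsDiscreteHorizontalLift I IB U' h) :
    ContMDiffOn (I.prod IB) (I.prod I) ∞ (extend h) U' := by
  intro x hx
  refine ContMDiffAt.contMDiffWithinAt ?_
  refine (contMDiffAt_subtype_iff (U := ⟨U', hh.isOpen⟩) (x := ⟨x, hx⟩)).1 ?_
  convert hh.contMDiff ⟨x, hx⟩ using 2 with y
  exact extend_apply (h := h) ⟨y.1, y.2⟩

theorem idProdQuotient_extend (hh : IsDiscreteHorizontalLift I IB U' h)
    {x : Q × MulAction.orbitRel.Quotient G Q} (hx : x ∈ U') :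
    idProdQuotient G Q (extend h x) = x := by
  rw [extend_apply (h := h) ⟨x, hx⟩]
  exact hh.is_section _

theorem idProdQuotient_mem (hh : IsDiscreteHorizontalLift I IB U' h) {p : Q × Q}
    (hp : p ∈ range h) : idProdQuotient G Q p ∈ U' := by
  obtain ⟨x, rfl⟩ := hp
  rw [hh.is_section]
  exact x.2

theorem apply_idProdQuotient (hh : IsDiscreteHorizontalLift I IB U' h) {p : Q × Q}
    (hp : p ∈ range h) : h ⟨idProdQuotient G Q p, hh.idProdQuotient_mem hp⟩ = p := by
  obtain ⟨x, rfl⟩ := hp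
  exact congrArg h (Subtype.ext (hh.is_section x))

/-- The homeomorphism of the range of a discrete horizontal lift with its domain. -/
noncomputable def homeomorphRange (hh : IsDiscreteHorizontalLift I IB U' h) : range h ≃ₜ U' where
  toFun p := ⟨idProdQuotient G Q p, hh.idProdQuotient_mem p.2⟩
  invFun x := ⟨h x, mem_range_self x⟩
  left_inv p := Subtype.ext (hh.apply_idProdQuotient p.2)
  right_inv x := Subtype.ext (hh.is_section x)
  continuous_toFun :=
    ((continuous_id.prodMap continuous_quotientMap).comp continuous_subtype_val).subtype_mk _
  continuous_invFun := hh.contMDiff.continuous.subtype_mk _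

theorem isOpenEmbedding_domRestrict (hh : IsDiscreteHorizontalLift I IB U' h) :
    Topology.IsOpenEmbedding ((range h).domRestrict (idProdQuotient G Q)) :=
  hh.isOpen.isOpenEmbedding_subtypeVal.comp hh.homeomorphRange.isOpenEmbedding

/-- A shear of the trivialization along the fibres: the new `G`-coordinate measures how far `q₁` is
from the lift of `(q₀, π(q₁))`, and equals `1` on the lift itself. -/
theorem exists_partialDiffeomorph [TopologicalSpace G] [ChartedSpace HG G] [LieGroup IG ∞ G]
    (hπ : IsPrincipalBundle I IG IB G Q) (hh : IsDiscreteHorizontalLift I IB U' h) (x : U') :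
    ∃ Ψ : PartialDiffeomorph (I.prod I) ((I.prod IB).prod IG) (Q × Q)
        ((Q × MulAction.orbitRel.Quotient G Q) × G) ∞,
      h x ∈ Ψ.source ∧ ∀ p ∈ range h, Ψ p = (idProdQuotient G Q p, 1) := by
  obtain ⟨e, hxe, ⟨V, hV, hs, ht⟩, he, he', hfst⟩ := hπ.exists_mem_source (h x).2
  have hU : IsOpen U' := hh.isOpen
  have hmem : ∀ y ∈ U', y.2 ∈ V → (extend h y).2 ∈ e.source := fun y hy hyV ↦ by
    rw [hs, mem_preimage]
    rwa [← hh.idProdQuotient_extend hy] at hyV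
  set k : Q × MulAction.orbitRel.Quotient G Q → G := fun y ↦ (e (extend h y).2).2 with hk
  set W : Set (Q × MulAction.orbitRel.Quotient G Q) := U' ∩ Prod.snd ⁻¹' V with hWdef
  have hW : IsOpen W := hU.inter (hV.preimage continuous_snd)
  have hkW : ContMDiffOn (I.prod IB) IG ∞ k W :=
    contMDiff_snd.comp_contMDiffOn (he.comp
      (contMDiff_snd.comp_contMDiffOn (hh.contMDiffOn_extend.mono inter_subset_left))
      fun y hy ↦ hmem y hy.1 hy.2)
  have hfste : ∀ p : Q × Q, idProdQuotient G Q p ∈ W → (e p.2).1 = quotientMap G Q p.2 :=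
    fun p hp ↦ hfst _ (by rw [hs]; exact hp.2)
  have hsymm : ∀ r ∈ V, ∀ g : G, quotientMap G Q (e.symm (r, g)) = r := fun r hr g ↦ by
    have htgt : (r, g) ∈ e.target := by rw [ht]; exact ⟨hr, trivial⟩
    rw [← hfst _ (e.map_target htgt), e.right_inv htgt]
  -- Smoothness of `π` is read off from the first component of the trivialization.
  have hπW : ContMDiffOn (I.prod I) (I.prod IB) ∞ (idProdQuotient G Q)
      (idProdQuotient G Q ⁻¹' W) := by
    refine ContMDiffOn.prodMk contMDiffOn_fst ?_
    refine (contMDiff_fst.comp_contMDiffOn (he.comp contMDiffOn_snd ?_)).congr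
      fun p hp ↦ (hfste p hp).symm
    intro p hp
    rw [hs]
    exact hp.2
  let Ψ : PartialDiffeomorph (I.prod I) ((I.prod IB).prod IG) (Q × Q)
        ((Q × MulAction.orbitRel.Quotient G Q) × G) ∞ :=
    { toFun := fun p ↦ (idProdQuotient G Q p, (k (idProdQuotient G Q p))⁻¹ * (e p.2).2)
      invFun := fun y ↦ (y.1.1, e.symm (y.1.2, k y.1 * y.2))
      source := idProdQuotient G Q ⁻¹' W
      target := W ×ˢ univ
      map_source' := fun p hp ↦ ⟨hp, trivial⟩
      map_target' := by
        rintro ⟨y, g⟩ ⟨hy, -⟩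
        change (y.1, quotientMap G Q (e.symm (y.2, k y * g))) ∈ W
        rwa [hsymm _ hy.2]
      left_inv' := by
        intro p hp
        refine Prod.ext rfl ?_
        change e.symm (quotientMap G Q p.2, _ * (_ * (e p.2).2)) = p.2
        rw [mul_inv_cancel_left, ← hfste p hp]
        exact e.left_inv (by rw [hs]; exact hp.2)
      right_inv' := by
        rintro ⟨y, g⟩ ⟨hy, -⟩
        have hy' : idProdQuotient G Q (y.1, e.symm (y.2, k y * g)) = y :=
          Prod.ext rfl (hsymm _ hy.2 _)
        have htgt : (y.2, k y * g) ∈ e.target := by rw [ht]; exact ⟨hy.2, trivial⟩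
        simp [hy', e.right_inv htgt]
      open_source := hW.preimage (continuous_id.prodMap continuous_quotientMap)
      open_target := hW.prod isOpen_univ
      contMDiffOn_toFun := by
        refine hπW.prodMk (((hkW.comp hπW fun p hp ↦ hp).inv).mul
          (contMDiff_snd.comp_contMDiffOn (he.comp contMDiffOn_snd ?_)))
        intro p hp
        rw [hs]
        exact hp.2
      contMDiffOn_invFun := by
        refine ContMDiffOn.prodMk (contMDiff_fst.comp contMDiff_fst).contMDiffOn
          (he'.comp (ContMDiffOn.prodMk (contMDiff_snd.comp contMDiff_fst).contMDiffOn
            ((hkW.comp contMDiffOn_fst fun y hy ↦ hy.1).mul contMDiffOn_snd)) ?_)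
        intro y hy
        rw [ht]
        exact ⟨hy.1.2, trivial⟩ }
  refine ⟨Ψ, ?_, ?_⟩
  · change idProdQuotient G Q (h x) ∈ W
    rw [hh.is_section]
    refine ⟨x.2, ?_⟩
    rw [hs, mem_preimage] at hxe
    rwa [mem_preimage, ← hh.is_section x]
  · rintro _ ⟨y, rfl⟩
    change (idProdQuotient G Q (h y), (k (idProdQuotient G Q (h y)))⁻¹ * (e (h y).2).2) = _
    rw [hh.is_section, hk]
    simp [extend_apply]

variable [FiniteDimensional ℝ E] [I.Boundaryless] [FiniteDimensional ℝ EB] [IB.Boundaryless]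
  [IsManifold I ∞ Q] [IsManifold IB ∞ (MulAction.orbitRel.Quotient G Q)]

theorem exists_embeddedSubmanifold [IG.Boundaryless] [TopologicalSpace G] [ChartedSpace HG G]
    [LieGroup IG ∞ G] (hπ : IsPrincipalBundle I IG IB G Q)
    (hh : IsDiscreteHorizontalLift I IB U' h) :
    ∃ σ : EmbeddedSubmanifold (I.prod I) (range h),
      σ.IsLocalDiffeomorphRestrict (I.prod IB) (idProdQuotient G Q) := by
  obtain ⟨cs, hcs, hloc⟩ :=
    hh.isOpenEmbedding_domRestrict.exists_euclidean_manifold (J := I.prod IB) (n := ∞)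
  refine ⟨⟨_, cs, hcs, ?_, Topology.IsEmbedding.subtypeVal⟩, hloc⟩
  -- The normal directions to `range h` are those of the fibre `G`.
  refine Manifold.IsImmersionOfComplement.isImmersion (F := EG) ?_
  rintro ⟨_, x, rfl⟩
  obtain ⟨Ψ, hx, hΨ⟩ := hh.exists_partialDiffeomorph hπ x
  exact .of_straightening (by simp) continuous_subtype_val.continuousAt (hloc _) Ψ hx (c := 1)
    fun y _ ↦ hΨ y y.2

/-- The discrete connection whose horizontal submanifold is the range of a discrete horizontal
lift. -/
def toDiscreteConnection [IG.Boundaryless] [TopologicalSpace G] [ChartedSpace HG G]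
    [LieGroup IG ∞ G] (hπ : IsPrincipalBundle I IG IB G Q)
    (hh : IsDiscreteHorizontalLift I IB U' h) : DiscreteConnection I IB G Q where
  Hor := range h
  smul_mem := by
    rintro g q₀ q₁ ⟨x, hx⟩
    exact ⟨_, (hh.equivariant g x x.2).trans (by rw [Subtype.coe_eta, hx])⟩
  diag_mem q := ⟨_, hh.map_diag q⟩
  injOn p hp p' hp' hpp' := by
    rw [← hh.apply_idProdQuotient hp, ← hh.apply_idProdQuotient hp']
    exact congrArg h (Subtype.ext hpp')
  exists_localDiffeomorph := hh.exists_embeddedSubmanifold hπ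

end IsDiscreteHorizontalLift

/-- The fibres of `π` are the orbits, so translating second components saturates `Hor`. -/
theorem DiscreteConnection.domain_eq_preimage (A : DiscreteConnection I IB G Q) :
    A.domain = idProdQuotient G Q ⁻¹' A.baseDomain := by
  ext ⟨q₀, q₁⟩
  constructor
  · rintro ⟨q, q', g, hp, hq⟩
    rw [hq]
    exact ⟨_, hp, by simp [idProdQuotient]⟩
  · rintro ⟨⟨q, q'⟩, hp, hq⟩
    obtain ⟨rfl, hq'⟩ := Prod.ext_iff.1 hq
    obtain ⟨g, rfl⟩ := quotientMap_eq_iff.1 hq'.symm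
    exact ⟨q, q', g, hp, rfl⟩

end DiscreteConn

theorem mainTheorem2
    {E H : Type*} [NormedAddCommGroup E] [NormedSpace ℝ E] [FiniteDimensional ℝ E]
    [TopologicalSpace H] (I : ModelWithCorners ℝ E H) [I.Boundaryless]
    {EG HG : Type*} [NormedAddCommGroup EG] [NormedSpace ℝ EG] [FiniteDimensional ℝ EG]
    [TopologicalSpace HG] (IG : ModelWithCorners ℝ EG HG) [IG.Boundaryless]
    {EB HB : Type*} [NormedAddCommGroup EB] [NormedSpace ℝ EB] [FiniteDimensional ℝ EB]
    [TopologicalSpace HB] (IB : ModelWithCorners ℝ EB HB) [IB.Boundaryless]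
    (G : Type*) [Group G] [TopologicalSpace G] [ChartedSpace HG G] [LieGroup IG ∞ G]
    (Q : Type*) [TopologicalSpace Q] [ChartedSpace H Q] [IsManifold I ∞ Q] [MulAction G Q]
    [ChartedSpace HB (MulAction.orbitRel.Quotient G Q)]
    [IsManifold IB ∞ (MulAction.orbitRel.Quotient G Q)]
    (hπ : DiscreteConn.IsPrincipalBundle I IG IB G Q) :
    (∀ A : DiscreteConn.DiscreteConnection I IB G Q,
      DiscreteConn.IsDiscreteHorizontalLift I IB A.baseDomain A.horizontalLift) ∧
    (∀ (U' : Set (Q × MulAction.orbitRel.Quotient G Q)) (h : U' → Q × Q),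
      DiscreteConn.IsDiscreteHorizontalLift I IB U' h →
      ∃! A : DiscreteConn.DiscreteConnection I IB G Q,
        A.domain = DiscreteConn.idProdQuotient G Q ⁻¹' U' ∧
        ∃ hU : A.baseDomain = U',
          ∀ (x : Q × MulAction.orbitRel.Quotient G Q) (hx : x ∈ A.baseDomain),
            A.horizontalLift ⟨x, hx⟩ = h ⟨x, hU ▸ hx⟩) := by
  open DiscreteConn in
  refine ⟨fun A ↦ A.isDiscreteHorizontalLift, fun U' h hh ↦ ?_⟩
  have hU : (hh.toDiscreteConnection hπ).baseDomain = U' := by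
    ext x
    refine ⟨?_, fun hx ↦ ⟨h ⟨x, hx⟩, Set.mem_range_self _, hh.is_section _⟩⟩
    rintro ⟨p, hp, rfl⟩
    exact hh.idProdQuotient_mem hp
  refine ⟨hh.toDiscreteConnection hπ, ⟨?_, hU, fun x hx ↦ ?_⟩, ?_⟩
  · rw [DiscreteConnection.domain_eq_preimage, hU]
  · exact (DiscreteConnection.horizontalLift_eq_iff _ _ _).2
      ⟨Set.mem_range_self _, hh.is_section _⟩
  · rintro A ⟨-, rfl, hA⟩
    -- All fields other than `Hor` are propositions, so comparing the sets `Hor` suffices.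
    ext p
    change p ∈ A.Hor ↔ p ∈ Set.range h
    have : A.horizontalLift = h := funext fun x ↦ hA x x.2
    rw [← this, A.range_horizontalLift]
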